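/- Let $\mathbb{N}=\{1,2,3,\dots\}$ and $\omega=\{0,1,2,\dots\}$. For a sequence $(x_n)_{n\in\omega}$ in $\mathbb{N}$ put $$FS(x_n)=\Big\{\sum_{n\in s}x_n : s\subseteq\omega \text{ finite and nonempty}\Big\}.$$ An ultrafilter $p$ on $\mathbb{N}$ is called \emph{strongly summable} if it has a base of such sets, i.e. for every $A\in p$ there is a sequence $(x_n)_{n\in\omega}$ in $\mathbb{N}$ with $FS(x_n)\in p$ and $FS(x_n)\subseteq A$. An ultrafilter $p$ on $\mathbb{N}$ is called \emph{rapid} if for every $f:\mathbb{N}\to\mathbb{N}$ there is $A\in p$ such that $|\{a\in A: a<f(i)\}|<i$ for all $i\in\mathbb{N}$ (equivalently, the $i$-th element of $A$ in increasing order is at least $f(i)$ for every $i$). **Theorem.** Every strongly summable ultrafilter on $(\mathbb{N},+)$ is rapid. -/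

import Mathlib

/-- The FS-set `FS(x_n) = {∑_{n ∈ s} x_n : s ⊆ ω finite and nonempty}` generated by a sequence
`x` of positive integers. The sum is computed in `ℕ`, since `ℕ+` has no zero. -/
def FSSet (x : ℕ → ℕ+) : Set ℕ+ :=
  {m | ∃ s : Finset ℕ, s.Nonempty ∧ (m : ℕ) = ∑ n ∈ s, (x n : ℕ)}

/-- The FS-set of a sequence agrees with the inductively defined `Hindman.FS` of Mathlib. -/
theorem FSSet_eq_hindmanFS (x : ℕ → ℕ+) : FSSet x = Hindman.FS (x : Stream' ℕ+) := by
  have succ_sum : ∀ (a : ℕ → ℕ+) (t : Finset ℕ),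
      ∑ n ∈ t.image Nat.succ, (a n : ℕ) = ∑ n ∈ t, (a (n + 1) : ℕ) := fun a t =>
    Finset.sum_image (fun _ _ _ _ h => Nat.succ_injective h)
  apply Set.Subset.antisymm
  · rintro m ⟨s, hs, hm⟩
    obtain ⟨N, hN⟩ : ∃ N, ∀ n ∈ s, n < N := ⟨s.sup id + 1, fun n hn =>
      Nat.lt_succ_of_le (Finset.le_sup (f := id) hn)⟩
    induction N generalizing x m s with
    | zero => exact absurd (hN _ hs.choose_spec) (Nat.not_lt_zero _)
    | succ N ih =>
      set t : Finset ℕ := (s.erase 0).image Nat.pred with ht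
      have hts : t.image Nat.succ = s.erase 0 := by
        ext n
        simp only [ht, Finset.mem_image, Finset.mem_erase]
        constructor
        · rintro ⟨_, ⟨k, ⟨hk, hks⟩, rfl⟩, rfl⟩
          rw [Nat.succ_pred hk]
          exact ⟨hk, hks⟩
        · rintro ⟨hn, hns⟩
          exact ⟨n.pred, ⟨n, ⟨hn, hns⟩, rfl⟩, Nat.succ_pred hn⟩
      have htN : ∀ n ∈ t, n < N := fun n hn => by
        have h1 : n + 1 ∈ s.erase 0 := hts ▸ Finset.mem_image_of_mem Nat.succ hn
        have := hN _ (Finset.mem_of_mem_erase h1)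
        omega
      have hsum := succ_sum x t
      rw [hts] at hsum
      by_cases h0 : 0 ∈ s
      · have hadd := Finset.add_sum_erase s (fun n => (x n : ℕ)) h0
        rcases t.eq_empty_or_nonempty with hte | hte
        · have : m = x 0 := by
            apply PNat.eq
            rw [hte, Finset.sum_empty] at hsum
            rw [hm, ← hadd, hsum, Nat.add_zero]
          rw [this]
          exact Hindman.FS.head' _
        · have hpos : 0 < ∑ n ∈ t, (x (n + 1) : ℕ) :=
            Finset.sum_pos (fun n _ => (x (n + 1)).pos) hte
          have hm' : m = x 0 + (∑ n ∈ t, (x (n + 1) : ℕ)).toPNat hpos := by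
            apply PNat.eq
            rw [PNat.add_coe, hm, ← hadd, hsum]
            rfl
          rw [hm']
          exact Hindman.FS.cons' _ _ (ih (fun n => x (n + 1)) t hte rfl htN)
      · rw [Finset.erase_eq_of_notMem h0] at hsum hts
        have hte : t.Nonempty := by
          rw [← Finset.image_nonempty (f := Nat.succ), hts]
          exact hs
        exact Hindman.FS.tail' _ _
          (ih (fun n => x (n + 1)) t hte (hm.trans hsum) htN)
  · intro m hm
    change Hindman.FS (x : Stream' ℕ+) m at hm
    induction hm with
    | head' a => exact ⟨{0}, Finset.singleton_nonempty 0, by simp; rfl⟩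
    | tail' a m _ ih =>
      obtain ⟨t, ht, hm⟩ := ih
      exact ⟨t.image Nat.succ, ht.image _, hm.trans (succ_sum a t).symm⟩
    | cons' a m _ ih =>
      obtain ⟨t, ht, hm⟩ := ih
      refine ⟨insert 0 (t.image Nat.succ), Finset.insert_nonempty _ _, ?_⟩
      rw [Finset.sum_insert (by simp), succ_sum a t, PNat.add_coe, hm]
      rfl

/-- An ultrafilter on the positive integers is strongly summable if it has a base of FS-sets. -/
def IsStronglySummable (p : Ultrafilter ℕ+) : Prop :=
  ∀ A ∈ p, ∃ x : ℕ → ℕ+, FSSet x ∈ p ∧ FSSet x ⊆ A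

/-- An ultrafilter on the positive integers is rapid if for every `f` it has a member `A` with
`|A ∩ f(i)| < i` for all `i`, where `f(i)` stands for the set of numbers below `f(i)`; that is,
the `i`-th element of `A` is at least `f(i)`. -/
def IsRapid (p : Ultrafilter ℕ+) : Prop :=
  ∀ f : ℕ+ → ℕ+, ∃ A ∈ p, ∀ i : ℕ+, (A ∩ Set.Iio (f i)).ncard < (i : ℕ)

/-! Write `v` for the 3-adic valuation. Colouring numbers by their last nonzero ternary digit makes
the generators of a monochromatic FS-set have distinct `v`. Adding to `x 0` a generator of huge
valuation enlarges it without changing `v`, so strong summability forces `F (v a) ≤ a` for `p`-most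
`a`, for any `F`. For fast growing `F`, the generators below `f i` then have `v < log₂ i`; there are
at most `log₂ i` of them, and they yield fewer than `i` sums below `f i`. -/

theorem mem_FSSet (x : ℕ → ℕ+) (n : ℕ) : x n ∈ FSSet x :=
  ⟨{n}, Finset.singleton_nonempty n, by simp⟩

theorem add_mem_FSSet (x : ℕ → ℕ+) {m n : ℕ} (h : m ≠ n) : x m + x n ∈ FSSet x :=
  ⟨{m, n}, Finset.insert_nonempty _ _, by rw [Finset.sum_pair h, PNat.add_coe]⟩

/-- The last nonzero digit in the base `3` expansion of a positive integer. -/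
def lastTernaryDigit (a : ℕ+) : ℕ := ((a : ℕ) / 3 ^ padicValNat 3 a) % 3

theorem exists_eq_three_pow_mul (a : ℕ+) :
    ∃ u : ℕ, (a : ℕ) = 3 ^ padicValNat 3 a * u ∧ u % 3 = lastTernaryDigit a ∧ u % 3 ≠ 0 := by
  obtain ⟨u, hu⟩ := pow_padicValNat_dvd (p := 3) (n := (a : ℕ))
  have hdiv : (a : ℕ) / 3 ^ padicValNat 3 a = u := Nat.div_eq_of_eq_mul_right (by positivity) hu
  refine ⟨u, hu, by rw [lastTernaryDigit, hdiv], fun h => ?_⟩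
  obtain ⟨w, hw⟩ := Nat.dvd_of_mod_eq_zero h
  refine pow_succ_padicValNat_not_dvd (p := 3) a.pos.ne' ⟨w, ?_⟩
  rw [pow_succ, mul_assoc, ← hw, ← hu]

theorem padicValNat_three_pow_mul {k u : ℕ} (hu : u % 3 ≠ 0) : padicValNat 3 (3 ^ k * u) = k := by
  rw [padicValNat.mul (by positivity) (by rintro rfl; simp at hu), padicValNat.prime_pow,
    padicValNat.eq_zero_of_not_dvd (fun h => hu (Nat.mod_eq_zero_of_dvd h)), add_zero]

/-- Two numbers with the same last nonzero ternary digit, at the same place, have a sum with a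
different one. -/
theorem lastTernaryDigit_add_ne {a b : ℕ+} (hv : padicValNat 3 a = padicValNat 3 b)
    (hd : lastTernaryDigit a = lastTernaryDigit b) :
    lastTernaryDigit (a + b) ≠ lastTernaryDigit a := by
  obtain ⟨u, hu, hud, hu0⟩ := exists_eq_three_pow_mul a
  obtain ⟨w, hw, hwd, hw0⟩ := exists_eq_three_pow_mul b
  have hsum : ((a + b : ℕ+) : ℕ) = 3 ^ padicValNat 3 a * (u + w) := by
    rw [PNat.add_coe, mul_add, ← hu, hv, ← hw]
  have hval : padicValNat 3 (a + b : ℕ+) = padicValNat 3 a := by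
    rw [hsum]
    -- Since `u ≡ w` mod 3, `u + w ≡ 2u`, which is neither `0` nor `u` mod 3.
    exact padicValNat_three_pow_mul (by omega)
  have hdig : lastTernaryDigit (a + b) = (u + w) % 3 := by
    rw [lastTernaryDigit, hval, hsum, Nat.mul_div_cancel_left _ (by positivity)]
  omega

theorem padicValNat_add_of_lt {a b : ℕ+} (h : padicValNat 3 a < padicValNat 3 b) :
    padicValNat 3 (a + b : ℕ+) = padicValNat 3 a := by
  obtain ⟨u, hu, -, hu0⟩ := exists_eq_three_pow_mul a
  obtain ⟨w, hw, -, -⟩ := exists_eq_three_pow_mul b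
  obtain ⟨d, hd⟩ := Nat.exists_eq_add_of_lt h
  have hsum : ((a + b : ℕ+) : ℕ) = 3 ^ padicValNat 3 a * (u + 3 * (3 ^ d * w)) := by
    rw [PNat.add_coe, mul_add, ← hu, hw, hd]
    ring
  rw [hsum]
  exact padicValNat_three_pow_mul (by omega)

/-- Two generators of equal valuation would have a sum of another colour. -/
theorem padicValNat_injective_of_FSSet_subset {x : ℕ → ℕ+} {c : ℕ}
    (h : FSSet x ⊆ {a | lastTernaryDigit a = c}) :
    Function.Injective fun n => padicValNat 3 (x n) := by
  intro m n hmn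
  by_contra hne
  have hm : lastTernaryDigit (x m) = c := h (mem_FSSet x m)
  have hn : lastTernaryDigit (x n) = c := h (mem_FSSet x n)
  exact lastTernaryDigit_add_ne hmn (hm.trans hn.symm)
    ((h (add_mem_FSSet x hne) : lastTernaryDigit _ = c).trans hm.symm)

theorem exists_lastTernaryDigit_eq_mem (p : Ultrafilter ℕ+) :
    ∃ c, {a | lastTernaryDigit a = c} ∈ p := by
  have hU : (⋃ c ∈ Set.Iio 3, {a : ℕ+ | lastTernaryDigit a = c}) ∈ p := by
    refine Filter.mem_of_superset Filter.univ_mem fun a _ => ?_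
    exact Set.mem_iUnion₂.2 ⟨lastTernaryDigit a, Nat.mod_lt _ three_pos, rfl⟩
  obtain ⟨c, -, hc⟩ := (Ultrafilter.finite_biUnion_mem_iff (Set.finite_Iio 3)).1 hU
  exact ⟨c, hc⟩

/-- For a strongly summable ultrafilter, most numbers are large compared with the position of
their last nonzero ternary digit. -/
theorem IsStronglySummable.setOf_le_mem {p : Ultrafilter ℕ+} (hp : IsStronglySummable p)
    (F : ℕ → ℕ) : {a : ℕ+ | F (padicValNat 3 a) ≤ a} ∈ p := by
  by_contra hF
  obtain ⟨c, hc⟩ := exists_lastTernaryDigit_eq_mem p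
  obtain ⟨x, -, hx⟩ := hp _ (Filter.inter_mem hc (Ultrafilter.compl_mem_iff_notMem.2 hF))
  have hinj := padicValNat_injective_of_FSSet_subset fun a ha => (hx ha).1
  set v := padicValNat 3 (x 0)
  -- Exceeding `v` keeps the valuation of `x 0 + x n` at `v`; exceeding `F v` makes `x n` larger
  -- than `F v`.
  obtain ⟨_, ⟨n, rfl⟩, hn⟩ := (Set.infinite_range_of_injective hinj).exists_gt (max v (F v))
  have hvn : v < padicValNat 3 (x n) := (le_max_left _ _).trans_lt hn
  have h0n : 0 ≠ n := by rintro rfl; exact hvn.false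
  refine (hx (add_mem_FSSet x h0n)).2 ?_
  have hpow : padicValNat 3 (x n) < 3 ^ padicValNat 3 (x n) := Nat.lt_pow_self (by norm_num)
  have hle : 3 ^ padicValNat 3 (x n) ≤ (x n : ℕ) := Nat.le_of_dvd (x n).pos pow_padicValNat_dvd
  have hFn : F v < padicValNat 3 (x n) := (le_max_right _ _).trans_lt hn
  change F (padicValNat 3 (x 0 + x n : ℕ+)) ≤ (x 0 + x n : ℕ+)
  rw [padicValNat_add_of_lt hvn, PNat.add_coe]
  exact (hFn.le.trans hpow.le).trans (hle.trans (Nat.le_add_left _ _))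

/-- If at most `k` terms of a sequence lie below `N`, then its FS-set has fewer than `2 ^ k`
elements below `N`. -/
theorem ncard_FSSet_inter_Iio_lt {x : ℕ → ℕ+} {N : ℕ+} {T : Finset ℕ}
    (hT : ∀ n, x n < N → n ∈ T) : (FSSet x ∩ Set.Iio N).ncard < 2 ^ T.card := by
  classical
  have hsub : (fun a : ℕ+ => (a : ℕ)) '' (FSSet x ∩ Set.Iio N) ⊆
      ((T.powerset.erase ∅).image fun s => ∑ n ∈ s, (x n : ℕ) : Finset ℕ) := by
    rintro _ ⟨a, ⟨⟨s, hs, ha⟩, haN⟩, rfl⟩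
    refine Finset.mem_coe.2 (Finset.mem_image.2 ⟨s, ?_, ha.symm⟩)
    refine Finset.mem_erase.2 ⟨hs.ne_empty, Finset.mem_powerset.2 fun n hn => hT n ?_⟩
    refine lt_of_le_of_lt (PNat.coe_le_coe _ _ |>.1 ?_) haN
    rw [ha]
    exact Finset.single_le_sum (f := fun n => (x n : ℕ)) (fun _ _ => Nat.zero_le _) hn
  have hcard := Set.ncard_le_ncard hsub (Finset.finite_toSet _)
  rw [Set.ncard_image_of_injective _ PNat.coe_injective, Set.ncard_coe_finset] at hcard
  refine (hcard.trans Finset.card_image_le).trans_lt ?_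
  -- Excluding the empty sum gives the strict inequality.
  rw [Finset.card_erase_of_mem (Finset.empty_mem_powerset T), Finset.card_powerset]
  exact Nat.sub_lt (by positivity) one_pos

theorem mainTheorem1 (p : Ultrafilter ℕ+) (hp : IsStronglySummable p) : IsRapid p := by
  intro f
  -- The sum bounds `f i` for all `i ≤ 2 ^ (k + 1)`, hence whenever `log₂ i ≤ k`.
  let F : ℕ → ℕ := fun k => ∑ j ∈ Finset.range (2 ^ (k + 1)), (f j.succPNat : ℕ)
  obtain ⟨c, hc⟩ := exists_lastTernaryDigit_eq_mem p
  obtain ⟨x, hxp, hx⟩ := hp _ (Filter.inter_mem hc (hp.setOf_le_mem F))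
  have hinj := padicValNat_injective_of_FSSet_subset fun a ha => (hx ha).1
  refine ⟨FSSet x, hxp, fun i => ?_⟩
  set k := Nat.log 2 i
  have hfin : {n | padicValNat 3 (x n) < k}.Finite :=
    (Set.finite_Iio k).preimage hinj.injOn
  have hT : ∀ n, x n < f i → n ∈ hfin.toFinset := by
    intro n hn
    rw [Set.Finite.mem_toFinset, Set.mem_ofPred_eq]
    by_contra! hk
    have hi : i.natPred < 2 ^ (padicValNat 3 (x n) + 1) :=
      (Nat.sub_le _ _).trans_lt ((Nat.lt_pow_succ_log_self one_lt_two (i : ℕ)).trans_le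
        (Nat.pow_le_pow_right two_pos (Nat.succ_le_succ hk)))
    have hle : (f i : ℕ) ≤ F (padicValNat 3 (x n)) := by
      have := Finset.single_le_sum (f := fun j : ℕ => (f j.succPNat : ℕ))
        (fun _ _ => Nat.zero_le _) (Finset.mem_range.2 hi)
      simpa only [PNat.succPNat_natPred] using this
    exact (hle.trans (hx (mem_FSSet x n)).2).not_gt hn
  refine (ncard_FSSet_inter_Iio_lt hT).trans_le ?_
  have hcard : hfin.toFinset.card ≤ k := by
    have := Finset.card_le_card_of_injOn (s := hfin.toFinset) (t := Finset.range k)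
      (fun n => padicValNat 3 (x n))
      (fun n hn => Finset.mem_coe.2 (Finset.mem_range.2 (hfin.mem_toFinset.1 hn))) hinj.injOn
    rwa [Finset.card_range] at this
  exact (Nat.pow_le_pow_right two_pos hcard).trans (Nat.pow_log_le_self 2 i.pos.ne')
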